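/- Let $1\le m\le n$, let $K_{m,n}$ be the complete bipartite graph with parts $V_1,V_2$, $|V_1|=m$, $|V_2|=n$, and let $\mathcal N$ be the set of its perfect matchings (the maximal matchings; they have $m$ edges). Let $U:\mathcal N\to\mathbb R$ be a utility function with maximum $U_{\max}$ and minimum $U_{\min}$, and let $\beta\ge 0$. The Markov chain $\mathcal M=\mathcal M(\beta,U)$ on $\mathcal N$ moves as follows. In state $M$, with $y\in V_1$ and $z\in V_2$ chosen uniformly at random and $z_1$ the partner of $y$ in $M$, let $\tilde M=M$ if $z=z_1$; let $\tilde M$ be $M$ with $(y,z_1)$ replaced by $(y,z)$ if $z$ is unmatched in $M$; and let $\tilde M$ be $M$ with $(y,z_1),(y_1,z)$ replaced by $(y,z),(y_1,z_1)$ if $z$ is the partner of some $y_1\ne y$. The chain moves to $\tilde M$ with probability $a_{M\tilde M}=\min\{1,e^{\beta(U(\tilde M)-U(M))}\}$ and stays at $M$ otherwise. The lazy version of $\mathcal M$ moves from $M$ to $M'$ with probability $a_{MM'}/(2mn)$ for every $M'\neq M$ that is a possible $\tilde M$ from $M$, and stays with the remaining probability. Let $\pi_M=e^{\beta U(M)}/\sum_{M'\in\mathcal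 N}e^{\beta U(M')}$. For a chain with transition matrix $P$ put $d(t)=\frac12\max_{M'}\sum_{M}|P^{t}_{M'M}-\pi_M|$ and $\tau_\epsilon=\min\{t: d(t)\le\epsilon\}$ for $\epsilon>0$. For a fixed $\beta\ge 0$ and a family of instances $(m_i,n_i,U_i)_{i\in I}$ with $1\le m_i\le n_i$, say that the chains are *rapidly mixing* if, for each $i$, $\pi$ is a stationary distribution of the $i$-th chain, and there are constants $C,k$ such that for all $i\in I$ and all $\epsilon>0$ the mixing time exists and $\tau_\epsilon\le C\,n_i^{k}\,(1+\max\{0,\ln(1/\epsilon)\})$. **Theorem.** Fix $\beta\ge0$ and a family of instances $(m_i,n_i,U_i)_{i\in I}$ with $1\le m_i\le n_i$. (1) If $U_{\max}-U_{\min}$ is bounded or grows at most logarithmically with the input size, i.e. there are constants $A,B$ with $U_{i,\max}-U_{i,\min}\le A+B\ln n_i$ for all $i$, then the chains $\mathcal M(\beta,U_i)$ are rapidly mixing, and so are their lazy versions. (2) Suppose that $U_{\max}-U_{\min}$ grows at most polynomially, and that the utilities, after adding constants $s_i\in\mathbb R$, are positive and not smaller than an inverse polynomial: there are constants $C>0$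 and $k\in\mathbb N$ with $U_{i,\max}-U_{i,\min}\le C n_i^{k}$ and $U_i(M)+s_i\ge 1/(C n_i^{k})$ for all $i$ and $M$. (One may take $s_i=0$ if the $U_i$ are bounded below by a positive constant. The choice $s_i=1-U_{i,\min}$ is always possible, after enlarging $C$ if necessary.) Then $\ln(U_i+s_i)$ has the same maximizing matchings as $U_i$, its range (maximum minus minimum) is at most $A+B\ln n_i$ for some constants $A,B$, and the chains $\mathcal M(\beta,\ln(U_i+s_i))$ and their lazy versions are rapidly mixing. -/

import Mathlib

/-- A set `E` of edges of the complete bipartite graph on `Fin m` and `Fin n` is a matching if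
distinct edges share no endpoint on either side. -/
def IsBipartiteMatching {m n : ℕ} (E : Finset (Fin m × Fin n)) : Prop :=
  ∀ e ∈ E, ∀ f ∈ E, e ≠ f → e.1 ≠ f.1 ∧ e.2 ≠ f.2

/-- A perfect matching is a matching to which no edge can be added. -/
def IsPerfectBipartiteMatching {m n : ℕ} (E : Finset (Fin m × Fin n)) : Prop :=
  IsBipartiteMatching E ∧ ∀ e, e ∉ E → ¬ IsBipartiteMatching (insert e E)

/-- The state space: perfect matchings of the complete bipartite graph with parts `Fin m` and
`Fin n`. For `m ≤ n` these are the injections sending each left node to its partner;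
see `isPerfectBipartiteMatching_iff`. -/
abbrev PerfectMatching (m n : ℕ) : Type := Fin m ↪ Fin n

/-- The edge set of a perfect matching. -/
def PerfectMatching.edges {m n : ℕ} (M : PerfectMatching m n) : Finset (Fin m × Fin n) :=
  Finset.univ.image fun y => (y, M y)

/-- For `m ≤ n`, the edge sets that are perfect matchings are exactly those of injections. -/
theorem isPerfectBipartiteMatching_iff {m n : ℕ} (hmn : m ≤ n) (E : Finset (Fin m × Fin n)) :
    IsPerfectBipartiteMatching E ↔ ∃ M : PerfectMatching m n, E = M.edges := by
  constructor
  · rintro ⟨hE, hmax⟩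
    have hinj : Set.InjOn Prod.fst (E : Set (Fin m × Fin n)) := by
      intro e he f hf h
      by_contra hne
      exact (hE e he f hf hne).1 h
    have hinj2 : Set.InjOn Prod.snd (E : Set (Fin m × Fin n)) := by
      intro e he f hf h
      by_contra hne
      exact (hE e he f hf hne).2 h
    have hcov : ∀ y : Fin m, ∃ z, (y, z) ∈ E := by
      intro y
      by_contra! hy
      have h1 : (E.image Prod.fst).card < m := by
        have : E.image Prod.fst ⊂ Finset.univ := by
          refine Finset.ssubset_univ_iff.2 fun h => ?_
          have := h ▸ Finset.mem_univ y
          obtain ⟨⟨a, b⟩, hab, rfl⟩ := Finset.mem_image.1 this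
          exact hy b hab
        simpa using Finset.card_lt_card this
      rw [Finset.card_image_of_injOn hinj] at h1
      have h2 : (E.image Prod.snd).card < n := by
        rw [Finset.card_image_of_injOn hinj2]; omega
      obtain ⟨z, hz⟩ : ∃ z, z ∉ E.image Prod.snd := by
        by_contra! h
        have : E.image Prod.snd = Finset.univ := Finset.eq_univ_iff_forall.2 h
        rw [this] at h2
        simp at h2
      have hz' : ∀ a, (a, z) ∉ E := fun a ha => hz (Finset.mem_image.2 ⟨_, ha, rfl⟩)
      refine hmax (y, z) (hy z) ?_
      rintro ⟨a, b⟩ he ⟨c, d⟩ hf hne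
      rw [Finset.mem_insert] at he hf
      rcases he with he | he <;> rcases hf with hf | hf
      · exact absurd (he.trans hf.symm) hne
      · cases he
        exact ⟨fun h => hy d (by rw [show y = c from h]; exact hf),
          fun h => hz' c (by rw [show z = d from h]; exact hf)⟩
      · cases hf
        exact ⟨fun h => hy b (by rw [← show a = y from h]; exact he),
          fun h => hz' a (by rw [← show b = z from h]; exact he)⟩
      · exact hE _ he _ hf hne
    choose M hM using hcov
    refine ⟨⟨M, fun a b h => ?_⟩, ?_⟩
    · exact congrArg Prod.fst (hinj2 (hM a) (hM b) h)
    · ext ⟨a, b⟩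
      simp only [PerfectMatching.edges, Finset.mem_image, Finset.mem_univ, true_and]
      constructor
      · intro h
        exact ⟨a, hinj (hM a) h rfl⟩
      · rintro ⟨y, hy⟩
        exact hy ▸ hM y
  · rintro ⟨M, rfl⟩
    have hmem : ∀ e : Fin m × Fin n, e ∈ M.edges ↔ M e.1 = e.2 := by
      rintro ⟨a, b⟩
      simp [PerfectMatching.edges]
    refine ⟨fun e he f hf hne => ?_, fun e he h => ?_⟩
    · rw [hmem] at he hf
      refine ⟨fun h => hne (Prod.ext h ?_), fun h => hne (Prod.ext (M.injective ?_) h)⟩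
      · rw [← he, ← hf, h]
      · rw [he, hf, h]
    · have h1 : (e.1, M e.1) ∈ M.edges := (hmem _).2 rfl
      refine (h e (Finset.mem_insert_self _ _) _ (Finset.mem_insert_of_mem h1) ?_).1 rfl
      intro h2
      exact he (h2 ▸ h1)

noncomputable section

/-- The matching proposed from `M` when the nodes `y`, `z` are selected: the roles of `z` and of the
partner `M y` of `y` are exchanged. So nothing changes if `z = M y`; if `z` is unmatched, then `y` is
rematched to `z`; if `z` is the partner of `y₁ ≠ y`, then `y` gets `z` and `y₁` gets `M y`. -/
def proposal {m n : ℕ} (M : PerfectMatching m n) (y : Fin m) (z : Fin n) : PerfectMatching m n :=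
  M.trans (Equiv.swap (M y) z).toEmbedding

/-- The probability of accepting the proposal `M'` in state `M`. -/
def acceptProb {m n : ℕ} (β : ℝ) (U : PerfectMatching m n → ℝ) (M M' : PerfectMatching m n) : ℝ :=
  min 1 (Real.exp (β * (U M' - U M)))

/-- The transition matrix of the algorithm: select `(y, z)` uniformly at random, move to the proposal
with the acceptance probability, and stay otherwise. -/
def transitionMatrix {m n : ℕ} (β : ℝ) (U : PerfectMatching m n → ℝ) :
    Matrix (PerfectMatching m n) (PerfectMatching m n) ℝ :=
  fun M M' => ∑ y : Fin m, ∑ z : Fin n, 1 / ((m : ℝ) * n) *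
    ((if M' = proposal M y z then acceptProb β U M (proposal M y z) else 0) +
      (if M' = M then 1 - acceptProb β U M (proposal M y z) else 0))

/-- Distinct matchings one of which is a proposal from the other. -/
def IsAdjacentMatching {m n : ℕ} (M M' : PerfectMatching m n) : Prop :=
  M ≠ M' ∧ ∃ y z, M' = proposal M y z

open Classical in
/-- Probability of the move from `M` to `M'` in the lazy version of the chain: it is
`acceptProb / (2mn)` if the matchings are adjacent, and zero otherwise. -/
def lazyMoveProb {m n : ℕ} (β : ℝ) (U : PerfectMatching m n → ℝ) (M M' : PerfectMatching m n) : ℝ :=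
  if IsAdjacentMatching M M' then 1 / (2 * (m : ℝ) * n) * acceptProb β U M M' else 0

/-- The transition matrix of the lazy version of the chain: moves have probability `lazyMoveProb`,
and the remaining probability is that of staying. -/
def lazyTransitionMatrix {m n : ℕ} (β : ℝ) (U : PerfectMatching m n → ℝ) :
    Matrix (PerfectMatching m n) (PerfectMatching m n) ℝ :=
  fun M M' => if M' = M then 1 - ∑ M'', lazyMoveProb β U M M'' else lazyMoveProb β U M M'

/-- The Gibbs distribution. -/
def gibbs {m n : ℕ} (β : ℝ) (U : PerfectMatching m n → ℝ) (M : PerfectMatching m n) : ℝ :=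
  Real.exp (β * U M) / ∑ M' : PerfectMatching m n, Real.exp (β * U M')

/-- `U_max - U_min`. -/
def utilityRange {m n : ℕ} (U : PerfectMatching m n → ℝ) : ℝ := (⨆ M, U M) - ⨅ M, U M

/-- `π` is a stationary distribution of the chain with transition matrix `P`. -/
def IsStationaryDistribution {Ω : Type*} [Fintype Ω] (P : Matrix Ω Ω ℝ) (π : Ω → ℝ) : Prop :=
  (∀ x, 0 ≤ π x) ∧ ∑ x, π x = 1 ∧ Matrix.vecMul π P = π

/-- The total variation distance `d(t)` to `π` after `t` steps, for the worst initial state. -/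
def tvDistance {Ω : Type*} [Fintype Ω] [DecidableEq Ω] (P : Matrix Ω Ω ℝ) (π : Ω → ℝ) (t : ℕ) : ℝ :=
  1 / 2 * ⨆ x, ∑ y, |(P ^ t) x y - π y|

/-- `τ = min {t | d(t) ≤ ε}`; in particular such `t` exist. -/
def IsMixingTime {Ω : Type*} [Fintype Ω] [DecidableEq Ω] (P : Matrix Ω Ω ℝ) (π : Ω → ℝ)
    (ε : ℝ) (τ : ℕ) : Prop :=
  IsLeast {t : ℕ | tvDistance P π t ≤ ε} τ

/-- A family of finite Markov chains with transition matrices `P i`, stationary distributions `π i`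
and input sizes `size i` is rapidly mixing: the `ε`-mixing times are bounded by a polynomial in the
input size times `1 + log⁺ (1 / ε)`. -/
def RapidlyMixing {ι : Type*} (size : ι → ℕ) (Ω : ι → Type*) [∀ i, Fintype (Ω i)]
    [∀ i, DecidableEq (Ω i)] (P : ∀ i, Matrix (Ω i) (Ω i) ℝ) (π : ∀ i, Ω i → ℝ) : Prop :=
  (∀ i, P i ∈ Matrix.rowStochastic ℝ (Ω i) ∧ IsStationaryDistribution (P i) (π i)) ∧
  ∃ (C : ℝ) (k : ℕ), ∀ i, ∀ ε : ℝ, 0 < ε → ∃ τ : ℕ, IsMixingTime (P i) (π i) ε τ ∧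
    (τ : ℝ) ≤ C * (size i : ℝ) ^ k * (1 + Real.posLog (1 / ε))

/-- Rapid mixing, for the inverse temperature `β` and the utility functions `U i` on the perfect
matchings of the complete bipartite graphs with parts of sizes `m i` and `n i`, of the chain run by
the algorithm and of its lazy version, both towards the Gibbs distribution. -/
def MatchingChainRapidlyMixing {ι : Type*} (β : ℝ) (m n : ι → ℕ)
    (U : ∀ i, PerfectMatching (m i) (n i) → ℝ) : Prop :=
  RapidlyMixing n (fun i => PerfectMatching (m i) (n i))
    (fun i => transitionMatrix β (U i)) (fun i => gibbs β (U i)) ∧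
  RapidlyMixing n (fun i => PerfectMatching (m i) (n i))
    (fun i => lazyTransitionMatrix β (U i)) (fun i => gibbs β (U i))

end

/-!
The symmetric group of the larger part acts transitively on the matchings `Fin m ↪ Fin n`, the
proposals are the moves by transpositions, and every permutation is a product of at most `n`
transpositions. The `ℓ²` distance between a function and its translate by a group element is
subadditive along such words, and averaging it over the group bounds the variance for the uniform
distribution by `n ^ 2` times the squared increments of the function along single transpositions.

Gibbs weights of two matchings differ at most by the factor `r = exp (|β| * utilityRange U)`. So the
uniform inequality becomes a Poincaré inequality for both chains, at the cost of `r` and of the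
proposal probabilities. Reversibility and holding turn it into a contraction of the variance by
`1 - 1 / (4 * n ^ 5 * r)` in each step. The variance of the density of the chain relative to the
Gibbs distribution controls the total variation distance, so the mixing time is polynomial in `n`
and `r`; and `r` is polynomial in `n` if the range of `U` is logarithmic. For part (2), the
logarithm of a utility bounded below by `1 / D` with range at most `D` has range at most
`log (1 + D ^ 2)`.
-/

section GroupActions

open scoped Pointwise

variable {G X : Type*} [Group G] [MulAction G X] [Fintype X]

/-- The `ℓ²` distance between a function `f` and its translate `x ↦ f (g • x)`. It is subadditive in
`g`, so it measures how `f` varies along a word in the generators of a group. -/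
noncomputable def displacement (f : X → ℝ) (g : G) : ℝ :=
  ‖WithLp.toLp 2 fun x => f (g • x) - f x‖

theorem displacement_nonneg (f : X → ℝ) (g : G) : 0 ≤ displacement f g :=
  norm_nonneg _

theorem displacement_sq (f : X → ℝ) (g : G) :
    displacement f g ^ 2 = ∑ x, (f (g • x) - f x) ^ 2 :=
  EuclideanSpace.real_norm_sq_eq _

theorem displacement_one (f : X → ℝ) : displacement f (1 : G) = 0 := by
  rw [← sq_eq_zero_iff, displacement_sq]
  simp only [one_smul, sub_self, zero_pow two_ne_zero, Finset.sum_const_zero]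

theorem norm_toLp_translate_eq_displacement (f : X → ℝ) (g h : G) :
    ‖WithLp.toLp 2 fun x => f (g • h • x) - f (h • x)‖ = displacement f g := by
  rw [← sq_eq_sq₀ (norm_nonneg _) (displacement_nonneg f g), displacement_sq,
    EuclideanSpace.real_norm_sq_eq]
  exact Equiv.sum_comp (MulAction.toPerm h) fun x => (f (g • x) - f x) ^ 2

theorem displacement_mul_le (f : X → ℝ) (g h : G) :
    displacement f (g * h) ≤ displacement f g + displacement f h :=
  calc displacement f (g * h)
      = ‖(WithLp.toLp 2 fun x => f (g • h • x) - f (h • x)) +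
          WithLp.toLp 2 fun x => f (h • x) - f x‖ := by
        rw [displacement, ← WithLp.toLp_add]
        congr 2
        ext x
        simp only [mul_smul, Pi.add_apply, sub_add_sub_cancel]
    _ ≤ displacement f g + displacement f h := by
        rw [← norm_toLp_translate_eq_displacement f g h]
        exact norm_add_le _ _

theorem displacement_le_of_mem_pow {f : X → ℝ} {S : Set G} {K : ℝ} (hK : 0 ≤ K)
    (hS : ∀ s ∈ S, displacement f s ≤ K) {k : ℕ} {g : G} (hg : g ∈ insert 1 S ^ k) :
    displacement f g ≤ k * K := by
  induction k generalizing g with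
  | zero =>
    obtain rfl : g = 1 := by simpa using hg
    simp [displacement_one]
  | succ k ih =>
    rw [pow_succ'] at hg
    obtain ⟨s, hs, h, hh, rfl⟩ := Set.mem_mul.1 hg
    have hs' : displacement f s ≤ K := by
      rcases hs with rfl | hs
      · exact (displacement_one f).trans_le hK
      · exact hS s hs
    calc displacement f (s * h) ≤ displacement f s + displacement f h := displacement_mul_le f s h
      _ ≤ K + k * K := add_le_add hs' (ih hh)
      _ = (k + 1 : ℕ) * K := by push_cast; ring

/-- Averaging over `g` the difference between `f (g • x)` and `f x` gives the difference between a
constant independent of `x` and `f x`, by transitivity. -/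
theorem exists_sum_sub_const_sq_le_of_displacement_le [Finite G] [MulAction.IsPretransitive G X]
    {f : X → ℝ} {K : ℝ} (hK : ∀ g : G, displacement f g ≤ K) :
    ∃ c : ℝ, ∑ x, (f x - c) ^ 2 ≤ K ^ 2 := by
  cases nonempty_fintype G
  rcases isEmpty_or_nonempty X with _ | ⟨⟨x₀⟩⟩
  · exact ⟨0, by simpa using sq_nonneg K⟩
  set N : ℝ := (Fintype.card G : ℝ)
  have hN : 0 < N := Nat.cast_pos.2 Fintype.card_pos
  set c : ℝ := (∑ g : G, f (g • x₀)) / N with hc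
  have sum_orbit (x : X) : ∑ g : G, f (g • x) = N * c := by
    obtain ⟨h, rfl⟩ := MulAction.exists_smul_eq G x₀ x
    rw [hc, mul_div_cancel₀ _ hN.ne']
    simp only [← mul_smul]
    exact Equiv.sum_comp (Equiv.mulRight h) fun g => f (g • x₀)
  have pointwise (x : X) : N * (f x - c) ^ 2 ≤ ∑ g : G, (f (g • x) - f x) ^ 2 := by
    have hsum : ∑ g : G, (f (g • x) - f x) = N * (c - f x) := by
      rw [Finset.sum_sub_distrib, sum_orbit, Finset.sum_const, nsmul_eq_mul, mul_sub,
        Finset.card_univ]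
    refine le_of_mul_le_mul_left ?_ hN
    calc N * (N * (f x - c) ^ 2) = (∑ g : G, (f (g • x) - f x)) ^ 2 := by rw [hsum]; ring
      _ ≤ N * ∑ g : G, (f (g • x) - f x) ^ 2 := sq_sum_le_card_mul_sum_sq (s := Finset.univ)
  refine ⟨c, le_of_mul_le_mul_left ?_ hN⟩
  calc N * ∑ x, (f x - c) ^ 2 ≤ ∑ x, ∑ g : G, (f (g • x) - f x) ^ 2 := by
        rw [Finset.mul_sum]
        exact Finset.sum_le_sum fun x _ => pointwise x
    _ = ∑ g : G, displacement f g ^ 2 := by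
        rw [Finset.sum_comm]
        simp only [displacement_sq]
    _ ≤ ∑ _g : G, K ^ 2 :=
        Finset.sum_le_sum fun g _ => pow_le_pow_left₀ (displacement_nonneg f g) (hK g) 2
    _ = N * K ^ 2 := by rw [Finset.sum_const, nsmul_eq_mul, Finset.card_univ]

end GroupActions

open scoped Pointwise in
theorem mem_insert_one_isSwap_pow {α : Type*} [Fintype α] [DecidableEq α] {k : ℕ}
    {g : Equiv.Perm α} (hg : g.support.card ≤ k) :
    g ∈ insert 1 {s : Equiv.Perm α | s.IsSwap} ^ k := by
  induction k generalizing g with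
  | zero => simpa using hg
  | succ k ih =>
    by_cases h : ∃ x, g x ≠ x
    · obtain ⟨x, hx⟩ := h
      have hcard : (Equiv.swap x (g x) * g).support.card ≤ k :=
        Nat.lt_succ_iff.1 ((Equiv.Perm.card_support_swap_mul hx).trans_le hg)
      rw [pow_succ', ← Equiv.swap_mul_self_mul x (g x) g]
      exact Set.mul_mem_mul (Or.inr ⟨x, g x, hx.symm, rfl⟩) (ih hcard)
    · rw [show g = 1 from Equiv.ext (not_exists_not.1 h)]
      exact Set.one_mem_pow (Set.mem_insert _ _)

section ReversibleChains

open scoped Matrix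

variable {Ω : Type*} [Fintype Ω] {P : Matrix Ω Ω ℝ} {π : Ω → ℝ}

/-- Detailed balance: the matrix `P` is reversible with respect to the weights `π`. -/
def DetailedBalance (P : Matrix Ω Ω ℝ) (π : Ω → ℝ) : Prop :=
  ∀ x y, π x * P x y = π y * P y x

/-- The variance of `f` under the weights `π`. The subtracted number is the mean of `f` if the
weights add up to `1`. -/
def weightedVariance (π f : Ω → ℝ) : ℝ :=
  ∑ x, π x * (f x - π ⬝ᵥ f) ^ 2

/-- The Dirichlet form of the transition matrix `P` with weights `π`: half the mean square increment
of `f` in one step. -/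
noncomputable def dirichletForm (P : Matrix Ω Ω ℝ) (π f : Ω → ℝ) : ℝ :=
  1 / 2 * ∑ x, ∑ y, π x * P x y * (f x - f y) ^ 2

theorem weightedVariance_add_sq_sub (hsum : ∑ x, π x = 1) (f : Ω → ℝ) (c : ℝ) :
    ∑ x, π x * (f x - c) ^ 2 = weightedVariance π f + (π ⬝ᵥ f - c) ^ 2 := by
  set μ := π ⬝ᵥ f
  have hmean : ∑ x, π x * f x = μ := rfl
  have hexpand (x : Ω) : π x * (f x - c) ^ 2 =
      π x * (f x - μ) ^ 2 + 2 * (μ - c) * (π x * f x) - (μ ^ 2 - c ^ 2) * π x := by ring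
  simp only [hexpand, Finset.sum_add_distrib, Finset.sum_sub_distrib, ← Finset.mul_sum, hsum, hmean,
    weightedVariance, μ]
  ring

theorem weightedVariance_le_sum (hsum : ∑ x, π x = 1) (f : Ω → ℝ) (c : ℝ) :
    weightedVariance π f ≤ ∑ x, π x * (f x - c) ^ 2 := by
  rw [weightedVariance_add_sq_sub hsum]
  exact le_add_of_nonneg_right (sq_nonneg _)

theorem weightedVariance_eq (hsum : ∑ x, π x = 1) (f : Ω → ℝ) :
    weightedVariance π f = ∑ x, π x * f x ^ 2 - (π ⬝ᵥ f) ^ 2 := by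
  simpa only [sub_zero, eq_sub_iff_add_eq] using (weightedVariance_add_sq_sub hsum f 0).symm

theorem dirichletForm_nonneg (hflow : ∀ x y, 0 ≤ π x * P x y) (f : Ω → ℝ) :
    0 ≤ dirichletForm P π f :=
  mul_nonneg one_half_pos.le <| Finset.sum_nonneg fun x _ => Finset.sum_nonneg fun y _ =>
    mul_nonneg (hflow x y) (sq_nonneg _)

theorem sq_sum_abs_sub_le_sum_mul_div_sub_one_sq (hπ : ∀ x, 0 < π x) (hsum : ∑ x, π x = 1)
    (μ : Ω → ℝ) : (∑ x, |μ x - π x|) ^ 2 ≤ ∑ x, π x * (μ x / π x - 1) ^ 2 := by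
  have habs (x : Ω) : |μ x - π x| = π x * |μ x / π x - 1| := by
    rw [← abs_of_pos (hπ x), ← abs_mul, abs_of_pos (hπ x), mul_sub, mul_one,
      mul_div_cancel₀ _ (hπ x).ne']
  calc (∑ x, |μ x - π x|) ^ 2 ≤ (∑ x, π x) * ∑ x, π x * (μ x / π x - 1) ^ 2 := by
        refine Finset.sum_sq_le_sum_mul_sum_of_sq_le_mul _ (fun x _ => (hπ x).le)
          (fun x _ => mul_nonneg (hπ x).le (sq_nonneg _)) fun x _ => ?_
        rw [habs, mul_pow, sq_abs]
        exact le_of_eq (by ring)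
    _ = ∑ x, π x * (μ x / π x - 1) ^ 2 := by rw [hsum, one_mul]

namespace DetailedBalance

theorem vecMul_eq [DecidableEq Ω] (h : DetailedBalance P π) (hP : P ∈ Matrix.rowStochastic ℝ Ω) :
    π ᵥ* P = π := by
  funext y
  simp only [Matrix.vecMul, dotProduct, h _ y]
  rw [← Finset.mul_sum, Matrix.sum_row_of_mem_rowStochastic hP, mul_one]

theorem dotProduct_mulVec_eq [DecidableEq Ω] (h : DetailedBalance P π)
    (hP : P ∈ Matrix.rowStochastic ℝ Ω) (f : Ω → ℝ) : π ⬝ᵥ P *ᵥ f = π ⬝ᵥ f := by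
  rw [Matrix.dotProduct_mulVec, h.vecMul_eq hP]

theorem pow [DecidableEq Ω] (h : DetailedBalance P π) (t : ℕ) : DetailedBalance (P ^ t) π := by
  have hconj : SemiconjBy (Matrix.diagonal π) P Pᵀ := by
    ext x y
    rw [Matrix.diagonal_mul, Matrix.mul_diagonal, Matrix.transpose_apply, h, mul_comm]
  intro x y
  have hxy := congrFun₂ (hconj.pow_right t).eq x y
  rwa [← Matrix.transpose_pow, Matrix.diagonal_mul, Matrix.mul_diagonal, Matrix.transpose_apply,
    mul_comm _ (π y)] at hxy

theorem sum_mul_mul_mulVec_comm (h : DetailedBalance P π) (f g : Ω → ℝ) :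
    ∑ x, π x * (f x * (P *ᵥ g) x) = ∑ x, π x * ((P *ᵥ f) x * g x) := by
  simp only [Matrix.mulVec, dotProduct, Finset.mul_sum, Finset.sum_mul]
  rw [Finset.sum_comm]
  refine Finset.sum_congr rfl fun y _ => Finset.sum_congr rfl fun x _ => ?_
  linear_combination f x * g y * h x y

theorem dirichletForm_eq [DecidableEq Ω] (h : DetailedBalance P π)
    (hP : P ∈ Matrix.rowStochastic ℝ Ω) (f : Ω → ℝ) :
    dirichletForm P π f = ∑ x, π x * f x ^ 2 - ∑ x, π x * (f x * (P *ᵥ f) x) := by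
  have hleft : ∑ x, ∑ y, π x * P x y * f x ^ 2 = ∑ x, π x * f x ^ 2 := by
    simp only [← Finset.sum_mul, ← Finset.mul_sum, Matrix.sum_row_of_mem_rowStochastic hP, mul_one]
  have hright : ∑ x, ∑ y, π x * P x y * f y ^ 2 = ∑ x, π x * f x ^ 2 := by
    rw [Finset.sum_comm, ← hleft]
    simp only [h _ _]
  have hcross : ∑ x, ∑ y, π x * P x y * (f x * f y) = ∑ x, π x * (f x * (P *ᵥ f) x) := by
    simp only [Matrix.mulVec, dotProduct, Finset.mul_sum]
    exact Finset.sum_congr rfl fun x _ => Finset.sum_congr rfl fun y _ => by ring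
  have hexpand (x y : Ω) : π x * P x y * (f x - f y) ^ 2 =
      π x * P x y * f x ^ 2 + π x * P x y * f y ^ 2 - 2 * (π x * P x y * (f x * f y)) := by ring
  simp only [dirichletForm, hexpand, Finset.sum_sub_distrib, Finset.sum_add_distrib,
    ← Finset.mul_sum, hleft, hright, hcross]
  ring

end DetailedBalance

theorem two_mul_mul_le_mul_self_apply (hP : ∀ x y, 0 ≤ P x y) {δ : ℝ} (hδ : ∀ x, δ ≤ P x x)
    {x y : Ω} (hxy : x ≠ y) : 2 * δ * P x y ≤ (P * P) x y := by
  classical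
  calc 2 * δ * P x y = δ * P x y + P x y * δ := by ring
    _ ≤ P x x * P x y + P x y * P y y :=
      add_le_add (mul_le_mul_of_nonneg_right (hδ x) (hP x y))
        (mul_le_mul_of_nonneg_left (hδ y) (hP x y))
    _ = ∑ z ∈ {x, y}, P x z * P z y := by rw [Finset.sum_pair hxy]
    _ ≤ (P * P) x y := by
      rw [Matrix.mul_apply]
      exact Finset.sum_le_sum_of_subset_of_nonneg (Finset.subset_univ _)
        fun z _ _ => mul_nonneg (hP x z) (hP z y)

theorem two_mul_mul_dirichletForm_le (hπ : ∀ x, 0 ≤ π x) (hP : ∀ x y, 0 ≤ P x y) {δ : ℝ}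
    (hδ : ∀ x, δ ≤ P x x) (f : Ω → ℝ) :
    2 * δ * dirichletForm P π f ≤ dirichletForm (P * P) π f := by
  have hterm (x y : Ω) :
      2 * δ * (π x * P x y * (f x - f y) ^ 2) ≤ π x * (P * P) x y * (f x - f y) ^ 2 := by
    rcases eq_or_ne x y with rfl | hxy
    · simp
    · linarith [mul_le_mul_of_nonneg_right (two_mul_mul_le_mul_self_apply hP hδ hxy)
        (mul_nonneg (hπ x) (sq_nonneg (f x - f y)))]
  rw [dirichletForm, dirichletForm, mul_left_comm]
  simp only [Finset.mul_sum (a := 2 * δ)]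
  exact mul_le_mul_of_nonneg_left
    (Finset.sum_le_sum fun x _ => Finset.sum_le_sum fun y _ => hterm x y) (by norm_num)

namespace DetailedBalance

variable [DecidableEq Ω]

/-- Since `∑ π (P f)² = ⟨f, P² f⟩`, one step decreases the variance by the Dirichlet form of `P²`,
and holding makes the moves of `P` appear in `P²`. -/
theorem weightedVariance_mulVec_le (h : DetailedBalance P π) (hπ : ∀ x, 0 ≤ π x)
    (hsum : ∑ x, π x = 1) (hP : P ∈ Matrix.rowStochastic ℝ Ω) {δ : ℝ} (hδ : ∀ x, δ ≤ P x x)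
    (f : Ω → ℝ) :
    weightedVariance π (P *ᵥ f) ≤ weightedVariance π f - 2 * δ * dirichletForm P π f := by
  have hsq : ∑ x, π x * (f x * ((P * P) *ᵥ f) x) = ∑ x, π x * (P *ᵥ f) x ^ 2 := by
    rw [← Matrix.mulVec_mulVec, h.sum_mul_mul_mulVec_comm]
    simp only [sq]
  have hdir : dirichletForm (P * P) π f = ∑ x, π x * f x ^ 2 - ∑ x, π x * (P *ᵥ f) x ^ 2 := by
    rw [← hsq, DetailedBalance.dirichletForm_eq (sq P ▸ h.pow 2) (mul_mem hP hP)]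
  rw [weightedVariance_eq hsum, weightedVariance_eq hsum, h.dotProduct_mulVec_eq hP]
  linarith [two_mul_mul_dirichletForm_le hπ hP.1 hδ f]

theorem weightedVariance_pow_mulVec_single (h : DetailedBalance P π) (hπ : ∀ x, 0 < π x)
    (hP : P ∈ Matrix.rowStochastic ℝ Ω) (t : ℕ) (x : Ω) :
    weightedVariance π (P ^ t *ᵥ Pi.single x (π x)⁻¹) =
      ∑ y, π y * ((P ^ t) x y / π y - 1) ^ 2 := by
  have hentry (y : Ω) : (P ^ t *ᵥ Pi.single x (π x)⁻¹) y = (P ^ t) x y / π y := by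
    rw [Matrix.mulVec_single, Pi.smul_apply, Matrix.col_apply, op_smul_eq_mul, ← div_eq_mul_inv,
      div_eq_div_iff (hπ x).ne' (hπ y).ne', mul_comm, mul_comm _ (π x)]
    exact h.pow t y x
  have hmean : π ⬝ᵥ P ^ t *ᵥ Pi.single x (π x)⁻¹ = 1 := by
    rw [(h.pow t).dotProduct_mulVec_eq (pow_mem hP t), dotProduct_single,
      mul_inv_cancel₀ (hπ x).ne']
  simp only [weightedVariance, hmean, hentry]

theorem sq_sum_abs_pow_sub_le (h : DetailedBalance P π) (hπ : ∀ x, 0 < π x)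
    (hsum : ∑ x, π x = 1) (hP : P ∈ Matrix.rowStochastic ℝ Ω) {γ : ℝ} (hγ : γ ≤ 1)
    (hgap : ∀ f, weightedVariance π (P *ᵥ f) ≤ (1 - γ) * weightedVariance π f) (t : ℕ) (x : Ω) :
    (∑ y, |(P ^ t) x y - π y|) ^ 2 ≤ (1 - γ) ^ t * (π x)⁻¹ := by
  set f : Ω → ℝ := Pi.single x (π x)⁻¹ with hf
  have hinit : weightedVariance π f ≤ (π x)⁻¹ := by
    have hsecond : ∑ y, π y * f y ^ 2 = (π x)⁻¹ := by
      rw [Finset.sum_eq_single x (fun y _ hy => by simp [hf, hy]) (by simp), hf, Pi.single_eq_same]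
      field_simp [(hπ x).ne']
    rw [weightedVariance_eq hsum, hsecond]
    exact sub_le_self _ (sq_nonneg _)
  have hdecay (s : ℕ) : weightedVariance π (P ^ s *ᵥ f) ≤ (1 - γ) ^ s * (π x)⁻¹ := by
    induction s with
    | zero => simpa using hinit
    | succ s ih =>
      rw [pow_succ', ← Matrix.mulVec_mulVec, pow_succ', mul_assoc]
      exact (hgap _).trans (mul_le_mul_of_nonneg_left ih (sub_nonneg.2 hγ))
  calc (∑ y, |(P ^ t) x y - π y|) ^ 2 ≤ ∑ y, π y * ((P ^ t) x y / π y - 1) ^ 2 :=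
        sq_sum_abs_sub_le_sum_mul_div_sub_one_sq hπ hsum _
    _ = weightedVariance π (P ^ t *ᵥ f) := (h.weightedVariance_pow_mulVec_single hπ hP t x).symm
    _ ≤ (1 - γ) ^ t * (π x)⁻¹ := hdecay t

end DetailedBalance

end ReversibleChains

section PoincareInequality

open scoped Pointwise

variable {G Ω : Type*} [Group G] [MulAction G Ω] [Fintype Ω] {P : Matrix Ω Ω ℝ} {π : Ω → ℝ}
  {C w : ℝ}

theorem mul_displacement_sq_le (hflow_nonneg : ∀ x y, 0 ≤ π x * P x y) (hC : 0 ≤ C) {g : G}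
    (hflow : ∀ x : Ω, g • x ≠ x → w ≤ C * (π x * P x (g • x))) (f : Ω → ℝ) :
    w * displacement f g ^ 2 ≤ 2 * C * dirichletForm P π f := by
  have hterm (x y : Ω) : 0 ≤ π x * P x y * (f x - f y) ^ 2 :=
    mul_nonneg (hflow_nonneg x y) (sq_nonneg _)
  have hpoint (x : Ω) :
      w * (f (g • x) - f x) ^ 2 ≤ C * ∑ y, π x * P x y * (f x - f y) ^ 2 := by
    by_cases hgx : g • x = x
    · rw [hgx, sub_self, zero_pow two_ne_zero, mul_zero]
      exact mul_nonneg hC (Finset.sum_nonneg fun y _ => hterm x y)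
    calc w * (f (g • x) - f x) ^ 2 ≤ C * (π x * P x (g • x)) * (f (g • x) - f x) ^ 2 :=
          mul_le_mul_of_nonneg_right (hflow x hgx) (sq_nonneg _)
      _ = C * (π x * P x (g • x) * (f x - f (g • x)) ^ 2) := by ring
      _ ≤ C * ∑ y, π x * P x y * (f x - f y) ^ 2 :=
          mul_le_mul_of_nonneg_left
            (Finset.single_le_sum (fun y _ => hterm x y) (Finset.mem_univ (g • x))) hC
  calc w * displacement f g ^ 2 ≤ ∑ x, C * ∑ y, π x * P x y * (f x - f y) ^ 2 := by
        rw [displacement_sq, Finset.mul_sum]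
        exact Finset.sum_le_sum fun x _ => hpoint x
    _ = 2 * C * dirichletForm P π f := by
        rw [← Finset.mul_sum, dirichletForm]
        ring

/-- The weights `π` are compared with the uniform weights `w`, for which the displacement along
words of length `k` gives the inequality. -/
theorem weightedVariance_le_mul_dirichletForm [Finite G] [MulAction.IsPretransitive G Ω]
    (hsum : ∑ x, π x = 1) (hflow_nonneg : ∀ x y, 0 ≤ π x * P x y) (hC : 0 ≤ C) (hw : 0 < w)
    (hπw : ∀ x, π x ≤ w) {S : Set G} {k : ℕ} (hS : ∀ g : G, g ∈ insert 1 S ^ k)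
    (hflow : ∀ s ∈ S, ∀ x : Ω, s • x ≠ x → w ≤ C * (π x * P x (s • x))) (f : Ω → ℝ) :
    weightedVariance π f ≤ 2 * C * k ^ 2 * dirichletForm P π f := by
  set K : ℝ := √(2 * C * dirichletForm P π f / w)
  have hdir : 0 ≤ dirichletForm P π f := dirichletForm_nonneg hflow_nonneg f
  have hgen (s : G) (hs : s ∈ S) : displacement f s ≤ K :=
    Real.le_sqrt_of_sq_le <| (le_div_iff₀' hw).2 <|
      mul_displacement_sq_le hflow_nonneg hC (hflow s hs) f
  obtain ⟨c, hc⟩ := exists_sum_sub_const_sq_le_of_displacement_le fun g =>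
    displacement_le_of_mem_pow (Real.sqrt_nonneg _) hgen (hS g)
  calc weightedVariance π f ≤ ∑ x, π x * (f x - c) ^ 2 := weightedVariance_le_sum hsum f c
    _ ≤ w * ∑ x, (f x - c) ^ 2 := by
        rw [Finset.mul_sum]
        exact Finset.sum_le_sum fun x _ => mul_le_mul_of_nonneg_right (hπw x) (sq_nonneg _)
    _ ≤ w * (k * K) ^ 2 := mul_le_mul_of_nonneg_left hc hw.le
    _ = 2 * C * k ^ 2 * dirichletForm P π f := by
        rw [mul_pow, Real.sq_sqrt (by positivity)]
        field_simp

end PoincareInequality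

section MixingTimes

variable {Ω : Type*} [Fintype Ω] [DecidableEq Ω] {P : Matrix Ω Ω ℝ} {π : Ω → ℝ} {ε : ℝ}

theorem DetailedBalance.isStationaryDistribution (h : DetailedBalance P π) (hπ : ∀ x, 0 ≤ π x)
    (hsum : ∑ x, π x = 1) (hP : P ∈ Matrix.rowStochastic ℝ Ω) : IsStationaryDistribution P π :=
  ⟨hπ, hsum, h.vecMul_eq hP⟩

theorem tvDistance_le [Nonempty Ω] {t : ℕ} (h : ∀ x, ∑ y, |(P ^ t) x y - π y| ≤ 2 * ε) :
    tvDistance P π t ≤ ε := by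
  rw [tvDistance]
  linarith [ciSup_le h]

theorem exists_isMixingTime_le_of_tvDistance_le {t : ℕ} (h : tvDistance P π t ≤ ε) :
    ∃ τ ≤ t, IsMixingTime P π ε τ := by
  classical
  have hex : ∃ s, tvDistance P π s ≤ ε := ⟨t, h⟩
  exact ⟨Nat.find hex, Nat.find_min' hex h, Nat.find_spec hex, fun s hs => Nat.find_min' hex hs⟩

theorem exp_neg_posLog_one_div_le (hε : 0 < ε) : Real.exp (-Real.posLog (1 / ε)) ≤ ε := by
  rw [← Real.le_log_iff_exp_le hε, neg_le, ← Real.log_inv, ← one_div]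
  exact le_max_right _ _

theorem one_sub_pow_mul_inv_le_sq {γ p : ℝ} (hγ : 0 < γ) (hγ_le : γ ≤ 1) (hp : 0 < p)
    (hε : 0 < ε) {t : ℕ} (ht : γ⁻¹ * (Real.log p⁻¹ + 2 * Real.posLog (1 / ε)) ≤ t) :
    (1 - γ) ^ t * p⁻¹ ≤ ε ^ 2 := by
  have hexponent : Real.log p⁻¹ + 2 * Real.posLog (1 / ε) ≤ t * γ := (inv_mul_le_iff₀' hγ).1 ht
  calc (1 - γ) ^ t * p⁻¹ ≤ Real.exp (-γ) ^ t * Real.exp (Real.log p⁻¹) := by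
        rw [Real.exp_log (inv_pos.2 hp)]
        gcongr
        exact Real.one_sub_le_exp_neg γ
    _ = Real.exp (t * -γ + Real.log p⁻¹) := by rw [← Real.exp_nat_mul, ← Real.exp_add]
    _ ≤ Real.exp ((2 : ℕ) * -Real.posLog (1 / ε)) := by
        gcongr
        push_cast
        linarith
    _ ≤ ε ^ 2 := by
        rw [Real.exp_nat_mul]
        exact pow_le_pow_left₀ (Real.exp_pos _).le (exp_neg_posLog_one_div_le hε) 2

theorem DetailedBalance.exists_isMixingTime_le [Nonempty Ω] (h : DetailedBalance P π)
    (hsum : ∑ x, π x = 1) (hP : P ∈ Matrix.rowStochastic ℝ Ω) {γ p : ℝ} (hγ : 0 < γ)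
    (hγ_le : γ ≤ 1)
    (hgap : ∀ f, weightedVariance π (P.mulVec f) ≤ (1 - γ) * weightedVariance π f)
    (hp : 0 < p) (hπ : ∀ x, p ≤ π x) (hε : 0 < ε) :
    ∃ τ : ℕ, IsMixingTime P π ε τ ∧
      (τ : ℝ) ≤ γ⁻¹ * (Real.log p⁻¹ + 2 * Real.posLog (1 / ε)) + 1 := by
  have hπ_pos (x : Ω) : 0 < π x := hp.trans_le (hπ x)
  have hp_le : p ≤ 1 := by
    obtain ⟨x⟩ := ‹Nonempty Ω›
    exact (hπ x).trans <| hsum ▸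
      Finset.single_le_sum (fun y _ => (hπ_pos y).le) (Finset.mem_univ x)
  set b : ℝ := γ⁻¹ * (Real.log p⁻¹ + 2 * Real.posLog (1 / ε))
  have hb : 0 ≤ b := mul_nonneg (inv_pos.2 hγ).le <| add_nonneg
    (Real.log_nonneg ((one_le_inv₀ hp).2 hp_le)) (mul_nonneg zero_le_two Real.posLog_nonneg)
  have htv (x : Ω) : ∑ y, |(P ^ ⌈b⌉₊) x y - π y| ≤ ε := by
    refine (sq_le_sq₀ (Finset.sum_nonneg fun _ _ => abs_nonneg _) hε.le).1 ?_
    calc (∑ y, |(P ^ ⌈b⌉₊) x y - π y|) ^ 2 ≤ (1 - γ) ^ ⌈b⌉₊ * (π x)⁻¹ :=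
          h.sq_sum_abs_pow_sub_le hπ_pos hsum hP hγ_le hgap _ x
      _ ≤ (1 - γ) ^ ⌈b⌉₊ * p⁻¹ :=
          mul_le_mul_of_nonneg_left (inv_anti₀ hp (hπ x)) (pow_nonneg (sub_nonneg.2 hγ_le) _)
      _ ≤ ε ^ 2 := one_sub_pow_mul_inv_le_sq hγ hγ_le hp hε (Nat.le_ceil b)
  obtain ⟨τ, hτ_le, hτ⟩ := exists_isMixingTime_le_of_tvDistance_le
    (tvDistance_le (ε := ε) fun x => (htv x).trans (by linarith))
  exact ⟨τ, hτ, (Nat.cast_le.2 hτ_le).trans (Nat.ceil_lt_add_one hb).le⟩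

end MixingTimes

section Proposals

variable {m n : ℕ}

theorem proposal_eq_swap_smul (M : PerfectMatching m n) (y : Fin m) (z : Fin n) :
    proposal M y z = Equiv.swap (M y) z • M :=
  rfl

theorem proposal_apply_self (M : PerfectMatching m n) (y : Fin m) (z : Fin n) :
    proposal M y z y = z :=
  Equiv.swap_apply_left (M y) z

theorem proposal_apply_partner (M : PerfectMatching m n) (y : Fin m) :
    proposal M y (M y) = M := by
  rw [proposal_eq_swap_smul, Equiv.swap_self, Equiv.Perm.one_def.symm, one_smul]

theorem proposal_proposal (M : PerfectMatching m n) (y : Fin m) (z : Fin n) :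
    proposal (proposal M y z) y (M y) = M := by
  rw [proposal_eq_swap_smul, proposal_apply_self, proposal_eq_swap_smul, smul_smul,
    Equiv.swap_comm, Equiv.swap_mul_self, one_smul]

theorem eq_proposal_comm (M M' : PerfectMatching m n) (y : Fin m) :
    M' = proposal M y (M' y) ↔ M = proposal M' y (M y) := by
  have hback {M M' : PerfectMatching m n} (h : M' = proposal M y (M' y)) :
      M = proposal M' y (M y) := by
    conv_rhs => rw [h]
    exact (proposal_proposal M y (M' y)).symm
  exact ⟨hback, hback⟩

theorem IsAdjacentMatching.symm {M M' : PerfectMatching m n} (h : IsAdjacentMatching M M') :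
    IsAdjacentMatching M' M := by
  obtain ⟨hne, y, z, rfl⟩ := h
  exact ⟨hne.symm, y, M y, (proposal_proposal M y z).symm⟩

theorem isAdjacentMatching_swap_smul {M : PerfectMatching m n} {a b : Fin n}
    (h : Equiv.swap a b • M ≠ M) : IsAdjacentMatching M (Equiv.swap a b • M) := by
  refine ⟨h.symm, ?_⟩
  by_contra! hnot
  refine h (Function.Embedding.ext fun y => Equiv.swap_apply_of_ne_of_ne ?_ ?_)
  · rintro rfl
    exact hnot y b rfl
  · rintro rfl
    exact hnot y a (by rw [proposal_eq_swap_smul, Equiv.swap_comm])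

/-- The number of nodes `y` whose selection may lead to the proposal of `M'` in state `M`. The other
selected node is then the partner of `y` in `M'`. -/
def proposalCount (M M' : PerfectMatching m n) : ℕ :=
  (Finset.univ.filter fun y => M' = proposal M y (M' y)).card

theorem proposalCount_comm (M M' : PerfectMatching m n) :
    proposalCount M M' = proposalCount M' M := by
  simp only [proposalCount, eq_proposal_comm M M']

theorem IsAdjacentMatching.one_le_proposalCount {M M' : PerfectMatching m n}
    (h : IsAdjacentMatching M M') : 1 ≤ proposalCount M M' := by
  obtain ⟨-, y, z, hyz⟩ := h
  have hz : M' y = z := by rw [hyz, proposal_apply_self]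
  exact Finset.card_pos.2 ⟨y, Finset.mem_filter.2 ⟨Finset.mem_univ y, hz ▸ hyz⟩⟩

end Proposals

section Gibbs

variable {m n : ℕ} {β : ℝ} {U : PerfectMatching m n → ℝ}

theorem acceptProb_nonneg (M M' : PerfectMatching m n) : 0 ≤ acceptProb β U M M' :=
  le_min zero_le_one (Real.exp_pos _).le

theorem acceptProb_le_one (M M' : PerfectMatching m n) : acceptProb β U M M' ≤ 1 :=
  min_le_left _ _

theorem acceptProb_self (M : PerfectMatching m n) : acceptProb β U M M = 1 := by
  rw [acceptProb, sub_self, mul_zero, Real.exp_zero, min_self]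

theorem gibbs_pos (M : PerfectMatching m n) : 0 < gibbs β U M :=
  div_pos (Real.exp_pos _) (Finset.sum_pos (fun _ _ => Real.exp_pos _) ⟨M, Finset.mem_univ _⟩)

theorem sum_gibbs [Nonempty (PerfectMatching m n)] : ∑ M, gibbs β U M = 1 := by
  simp only [gibbs, ← Finset.sum_div]
  exact div_self (Finset.sum_pos (fun _ _ => Real.exp_pos _) Finset.univ_nonempty).ne'

theorem gibbs_mul_exp (M M' : PerfectMatching m n) :
    gibbs β U M * Real.exp (β * (U M' - U M)) = gibbs β U M' := by
  rw [gibbs, gibbs, div_mul_eq_mul_div, ← Real.exp_add]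
  ring_nf

theorem gibbs_mul_acceptProb (M M' : PerfectMatching m n) :
    gibbs β U M * acceptProb β U M M' = min (gibbs β U M) (gibbs β U M') := by
  rw [acceptProb, mul_min_of_nonneg _ _ (gibbs_pos M).le, mul_one, gibbs_mul_exp]

theorem gibbs_mul_acceptProb_comm (M M' : PerfectMatching m n) :
    gibbs β U M * acceptProb β U M M' = gibbs β U M' * acceptProb β U M' M := by
  rw [gibbs_mul_acceptProb, gibbs_mul_acceptProb, min_comm]

theorem sub_le_utilityRange (U : PerfectMatching m n → ℝ) (M M' : PerfectMatching m n) :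
    U M - U M' ≤ utilityRange U :=
  sub_le_sub (le_ciSup (Set.finite_range U).bddAbove M)
    (ciInf_le (Set.finite_range U).bddBelow M')

theorem utilityRange_nonneg [Nonempty (PerfectMatching m n)] (U : PerfectMatching m n → ℝ) :
    0 ≤ utilityRange U := by
  obtain ⟨M⟩ := ‹Nonempty (PerfectMatching m n)›
  exact (sub_self (U M)).symm.trans_le (sub_le_utilityRange U M M)

theorem utilityRange_le [Nonempty (PerfectMatching m n)] {R : ℝ} (h : ∀ M M', U M - U M' ≤ R) :
    utilityRange U ≤ R := by
  obtain ⟨M, hM⟩ := exists_eq_ciSup_of_finite (f := U)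
  obtain ⟨M', hM'⟩ := exists_eq_ciInf_of_finite (f := U)
  rw [utilityRange, ← hM, ← hM']
  exact h M M'

theorem gibbs_le_exp_mul_gibbs (M M' : PerfectMatching m n) :
    gibbs β U M ≤ Real.exp (|β| * utilityRange U) * gibbs β U M' := by
  have habs : |U M - U M'| ≤ utilityRange U :=
    abs_le.2 ⟨neg_le.1 ((neg_sub _ _).trans_le (sub_le_utilityRange U M' M)),
      sub_le_utilityRange U M M'⟩
  have hexponent : β * (U M - U M') ≤ |β| * utilityRange U :=
    (le_abs_self _).trans <| (abs_mul _ _).trans_le (mul_le_mul_of_nonneg_left habs (abs_nonneg β))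
  rw [← gibbs_mul_exp M' M, mul_comm]
  exact mul_le_mul_of_nonneg_right (Real.exp_le_exp.2 hexponent) (gibbs_pos M').le

theorem inv_pow_mul_exp_le_gibbs (M : PerfectMatching m n) :
    ((n : ℝ) ^ m * Real.exp (|β| * utilityRange U))⁻¹ ≤ gibbs β U M := by
  have hne : Nonempty (PerfectMatching m n) := ⟨M⟩
  have hcard : Fintype.card (PerfectMatching m n) ≤ n ^ m := by
    simpa only [Fintype.card_embedding_eq, Fintype.card_fin] using Nat.descFactorial_le_pow n m
  set r : ℝ := Real.exp (|β| * utilityRange U)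
  have hM : 0 < gibbs β U M := gibbs_pos M
  refine inv_le_of_inv_le₀ hM ((inv_le_iff_one_le_mul₀ hM).2 ?_)
  calc (1 : ℝ) = ∑ M', gibbs β U M' := sum_gibbs.symm
    _ ≤ ∑ _M' : PerfectMatching m n, r * gibbs β U M :=
        Finset.sum_le_sum fun M' _ => gibbs_le_exp_mul_gibbs M' M
    _ = (Fintype.card (PerfectMatching m n) : ℕ) * (r * gibbs β U M) := by
        rw [Finset.sum_const, nsmul_eq_mul, Finset.card_univ]
    _ ≤ (n ^ m : ℕ) * (r * gibbs β U M) :=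
        mul_le_mul_of_nonneg_right (Nat.cast_le.2 hcard) (mul_nonneg (Real.exp_pos _).le hM.le)
    _ = (n : ℝ) ^ m * r * gibbs β U M := by push_cast; ring

end Gibbs

section TransitionMatrices

variable {m n : ℕ} {β : ℝ} {U : PerfectMatching m n → ℝ}

theorem lazyMoveProb_nonneg (M M' : PerfectMatching m n) : 0 ≤ lazyMoveProb β U M M' := by
  rw [lazyMoveProb]
  split_ifs
  · exact mul_nonneg (by positivity) (acceptProb_nonneg M M')
  · exact le_rfl

theorem lazyMoveProb_self (M : PerfectMatching m n) : lazyMoveProb β U M M = 0 :=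
  if_neg fun h => h.1 rfl

theorem gibbs_mul_lazyMoveProb {M M' : PerfectMatching m n} (h : IsAdjacentMatching M M') :
    gibbs β U M * lazyMoveProb β U M M' =
      1 / (2 * (m : ℝ) * n) * min (gibbs β U M) (gibbs β U M') := by
  rw [lazyMoveProb, if_pos h, mul_left_comm, gibbs_mul_acceptProb]

theorem gibbs_mul_lazyMoveProb_comm (M M' : PerfectMatching m n) :
    gibbs β U M * lazyMoveProb β U M M' = gibbs β U M' * lazyMoveProb β U M' M := by
  by_cases h : IsAdjacentMatching M M'
  · rw [gibbs_mul_lazyMoveProb h, gibbs_mul_lazyMoveProb h.symm, min_comm]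
  · rw [lazyMoveProb, lazyMoveProb, if_neg h, if_neg (mt IsAdjacentMatching.symm h), mul_zero,
      mul_zero]

theorem transitionMatrix_summand_nonneg (M M' : PerfectMatching m n) (y : Fin m) (z : Fin n) :
    0 ≤ 1 / ((m : ℝ) * n) *
      ((if M' = proposal M y z then acceptProb β U M (proposal M y z) else 0) +
        (if M' = M then 1 - acceptProb β U M (proposal M y z) else 0)) := by
  refine mul_nonneg (by positivity) (add_nonneg ?_ ?_)
  · exact ite_nonneg (acceptProb_nonneg _ _) le_rfl
  · exact ite_nonneg (sub_nonneg.2 (acceptProb_le_one _ _)) le_rfl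

theorem transitionMatrix_nonneg (M M' : PerfectMatching m n) : 0 ≤ transitionMatrix β U M M' :=
  Finset.sum_nonneg fun y _ => Finset.sum_nonneg fun z _ => transitionMatrix_summand_nonneg M M' y z

theorem sum_transitionMatrix (hm : 0 < m) (hn : 0 < n) (M : PerfectMatching m n) :
    ∑ M', transitionMatrix β U M M' = 1 := by
  have hproposal (y : Fin m) (z : Fin n) : ∑ M', 1 / ((m : ℝ) * n) *
      ((if M' = proposal M y z then acceptProb β U M (proposal M y z) else 0) +
        (if M' = M then 1 - acceptProb β U M (proposal M y z) else 0)) = 1 / ((m : ℝ) * n) := by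
    simp only [← Finset.mul_sum, Finset.sum_add_distrib, Finset.sum_ite_eq', Finset.mem_univ,
      if_true, add_sub_cancel, mul_one]
  simp only [transitionMatrix]
  rw [Finset.sum_comm]
  simp only [Finset.sum_comm (s := Finset.univ (α := PerfectMatching m n)), hproposal,
    Finset.sum_const, Finset.card_univ, Fintype.card_fin, nsmul_eq_mul]
  field_simp

theorem transitionMatrix_mem_rowStochastic (hm : 0 < m) (hn : 0 < n) :
    transitionMatrix β U ∈ Matrix.rowStochastic ℝ (PerfectMatching m n) :=
  Matrix.mem_rowStochastic_iff_sum.2 ⟨transitionMatrix_nonneg, sum_transitionMatrix hm hn⟩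

theorem transitionMatrix_of_ne {M M' : PerfectMatching m n} (h : M' ≠ M) :
    transitionMatrix β U M M' = proposalCount M M' * (1 / ((m : ℝ) * n) * acceptProb β U M M') := by
  have hselect (y : Fin m) : ∑ z : Fin n, 1 / ((m : ℝ) * n) *
      ((if M' = proposal M y z then acceptProb β U M (proposal M y z) else 0) +
        (if M' = M then 1 - acceptProb β U M (proposal M y z) else 0)) =
      if M' = proposal M y (M' y) then 1 / ((m : ℝ) * n) * acceptProb β U M M' else 0 := by
    rw [Finset.sum_eq_single_of_mem (M' y) (Finset.mem_univ _)]
    · split_ifs with hM'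
      · rw [← hM', add_zero]
      · rw [add_zero, mul_zero]
    · rintro z - hz
      have hM' : M' ≠ proposal M y z := by
        rintro rfl
        exact hz (proposal_apply_self M y z).symm
      rw [if_neg hM', if_neg h, add_zero, mul_zero]
  simp only [transitionMatrix, hselect]
  rw [← Finset.sum_filter, Finset.sum_const, nsmul_eq_mul, proposalCount]

theorem detailedBalance_transitionMatrix :
    DetailedBalance (transitionMatrix β U) (gibbs β U) := by
  intro M M'
  rcases eq_or_ne M M' with rfl | h
  · rfl
  rw [transitionMatrix_of_ne h.symm, transitionMatrix_of_ne h, proposalCount_comm]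
  linear_combination
    proposalCount M' M * (1 / ((m : ℝ) * n)) * gibbs_mul_acceptProb_comm (β := β) (U := U) M M'

theorem one_div_le_transitionMatrix_self (hm : 0 < m) (M : PerfectMatching m n) :
    1 / (n : ℝ) ≤ transitionMatrix β U M M := by
  calc 1 / (n : ℝ) = ∑ _y : Fin m, 1 / ((m : ℝ) * n) := by
        rw [Finset.sum_const, Finset.card_univ, Fintype.card_fin, nsmul_eq_mul]
        field_simp
    _ ≤ transitionMatrix β U M M := by
        refine Finset.sum_le_sum fun y _ => le_of_eq_of_le ?_ (Finset.single_le_sum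
          (fun z _ => transitionMatrix_summand_nonneg M M y z) (Finset.mem_univ (M y)))
        rw [proposal_apply_partner, if_pos rfl, acceptProb_self, sub_self, ite_self, add_zero,
          mul_one]

theorem two_mul_lazyMoveProb_le_transitionMatrix (M M' : PerfectMatching m n) :
    2 * lazyMoveProb β U M M' ≤ transitionMatrix β U M M' := by
  by_cases h : IsAdjacentMatching M M'
  · have hmove : 0 ≤ 1 / ((m : ℝ) * n) * acceptProb β U M M' :=
      mul_nonneg (by positivity) (acceptProb_nonneg M M')
    calc 2 * lazyMoveProb β U M M' = 1 / ((m : ℝ) * n) * acceptProb β U M M' := by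
          rw [lazyMoveProb, if_pos h]
          field_simp
      _ ≤ proposalCount M M' * (1 / ((m : ℝ) * n) * acceptProb β U M M') :=
          le_mul_of_one_le_left hmove (Nat.one_le_cast.2 h.one_le_proposalCount)
      _ = transitionMatrix β U M M' := (transitionMatrix_of_ne h.1.symm).symm
  · rw [lazyMoveProb, if_neg h, mul_zero]
    exact transitionMatrix_nonneg M M'

theorem sum_lazyMoveProb_le (hm : 0 < m) (hn : 0 < n) (M : PerfectMatching m n) :
    ∑ M', lazyMoveProb β U M M' ≤ 1 / 2 := by
  have h := Finset.sum_le_sum fun M' (_ : M' ∈ Finset.univ) =>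
    two_mul_lazyMoveProb_le_transitionMatrix (β := β) (U := U) M M'
  rw [← Finset.mul_sum, sum_transitionMatrix hm hn] at h
  linarith

theorem lazyTransitionMatrix_of_ne {M M' : PerfectMatching m n} (h : M' ≠ M) :
    lazyTransitionMatrix β U M M' = lazyMoveProb β U M M' :=
  if_neg h

theorem one_half_le_lazyTransitionMatrix_self (hm : 0 < m) (hn : 0 < n) (M : PerfectMatching m n) :
    1 / 2 ≤ lazyTransitionMatrix β U M M := by
  rw [lazyTransitionMatrix, if_pos rfl]
  linarith [sum_lazyMoveProb_le (β := β) (U := U) hm hn M]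

theorem lazyMoveProb_le_lazyTransitionMatrix (hm : 0 < m) (hn : 0 < n)
    (M M' : PerfectMatching m n) : lazyMoveProb β U M M' ≤ lazyTransitionMatrix β U M M' := by
  rcases eq_or_ne M' M with rfl | h
  · rw [lazyMoveProb_self]
    exact one_half_pos.le.trans (one_half_le_lazyTransitionMatrix_self hm hn M')
  · exact (lazyTransitionMatrix_of_ne h).ge

theorem sum_lazyTransitionMatrix (M : PerfectMatching m n) :
    ∑ M', lazyTransitionMatrix β U M M' = 1 := by
  have hsplit (M' : PerfectMatching m n) : lazyTransitionMatrix β U M M' =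
      (if M' = M then 1 - ∑ M'', lazyMoveProb β U M M'' else 0) + lazyMoveProb β U M M' := by
    rcases eq_or_ne M' M with rfl | h
    · rw [lazyTransitionMatrix, if_pos rfl, if_pos rfl, lazyMoveProb_self, add_zero]
    · rw [lazyTransitionMatrix_of_ne h, if_neg h, zero_add]
  simp only [hsplit, Finset.sum_add_distrib, Finset.sum_ite_eq', Finset.mem_univ, if_true,
    sub_add_cancel]

theorem lazyTransitionMatrix_mem_rowStochastic (hm : 0 < m) (hn : 0 < n) :
    lazyTransitionMatrix β U ∈ Matrix.rowStochastic ℝ (PerfectMatching m n) :=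
  Matrix.mem_rowStochastic_iff_sum.2
    ⟨fun M M' => (lazyMoveProb_nonneg M M').trans (lazyMoveProb_le_lazyTransitionMatrix hm hn M M'),
      sum_lazyTransitionMatrix⟩

theorem detailedBalance_lazyTransitionMatrix :
    DetailedBalance (lazyTransitionMatrix β U) (gibbs β U) := by
  intro M M'
  rcases eq_or_ne M M' with rfl | h
  · rfl
  rw [lazyTransitionMatrix_of_ne h.symm, lazyTransitionMatrix_of_ne h, gibbs_mul_lazyMoveProb_comm]

end TransitionMatrices

/-- The common properties of the chain and its lazy version on which rapid mixing rests:
reversibility with respect to the Gibbs distribution, holding probabilities of order at least `1/n`,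
and moves at least as likely as those of the lazy version. -/
structure IsMetropolisChain {m n : ℕ} (β : ℝ) (U : PerfectMatching m n → ℝ)
    (P : Matrix (PerfectMatching m n) (PerfectMatching m n) ℝ) : Prop where
  stochastic : P ∈ Matrix.rowStochastic ℝ (PerfectMatching m n)
  balance : DetailedBalance P (gibbs β U)
  holding : ∀ M, 1 / (2 * (n : ℝ)) ≤ P M M
  move : ∀ M M', lazyMoveProb β U M M' ≤ P M M'

theorem log_pow_mul_exp_le {x : ℝ} {m : ℕ} (hx : 1 ≤ x) (hm : m ≤ x) {b : ℝ} (hb : 0 ≤ b) :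
    Real.log (x ^ m * Real.exp b) ≤ 2 * x ^ 2 * Real.exp b := by
  have hx_pos : 0 < x := one_pos.trans_le hx
  calc Real.log (x ^ m * Real.exp b) = m * Real.log x + b := by
        rw [Real.log_mul (pow_pos hx_pos m).ne' (Real.exp_pos b).ne', Real.log_pow, Real.log_exp]
    _ ≤ x * x + Real.exp b := add_le_add
        (mul_le_mul hm (Real.log_le_self hx_pos.le) (Real.log_nonneg hx) hx_pos.le)
        ((le_add_of_nonneg_right zero_le_one).trans (Real.add_one_le_exp b))
    _ ≤ x ^ 2 * Real.exp b + x ^ 2 * Real.exp b := by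
        rw [← sq]
        gcongr
        · exact le_mul_of_one_le_right (sq_nonneg x) (Real.one_le_exp hb)
        · exact le_mul_of_one_le_left (Real.exp_pos b).le (one_le_pow₀ hx)
    _ = 2 * x ^ 2 * Real.exp b := by ring

section MetropolisChains

variable {m n : ℕ} {β : ℝ} {U : PerfectMatching m n → ℝ}

theorem isMetropolisChain_transitionMatrix (hm : 0 < m) (hn : 0 < n) :
    IsMetropolisChain β U (transitionMatrix β U) where
  stochastic := transitionMatrix_mem_rowStochastic hm hn
  balance := detailedBalance_transitionMatrix
  holding M := by
    refine le_trans ?_ (one_div_le_transitionMatrix_self hm M)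
    gcongr
    exact le_mul_of_one_le_left n.cast_nonneg one_le_two
  move M M' := by
    linarith [lazyMoveProb_nonneg (β := β) (U := U) M M',
      two_mul_lazyMoveProb_le_transitionMatrix (β := β) (U := U) M M']

theorem isMetropolisChain_lazyTransitionMatrix (hm : 0 < m) (hn : 0 < n) :
    IsMetropolisChain β U (lazyTransitionMatrix β U) where
  stochastic := lazyTransitionMatrix_mem_rowStochastic hm hn
  balance := detailedBalance_lazyTransitionMatrix
  holding M := by
    refine le_trans ?_ (one_half_le_lazyTransitionMatrix_self hm hn M)
    gcongr
    exact le_mul_of_one_le_right zero_le_two (Nat.one_le_cast.2 hn)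
  move := lazyMoveProb_le_lazyTransitionMatrix hm hn

namespace IsMetropolisChain

variable {P : Matrix (PerfectMatching m n) (PerfectMatching m n) ℝ}

theorem gibbs_le_mul_flow (hP : IsMetropolisChain β U P) (hm : 0 < m) (hn : 0 < n)
    {M M' : PerfectMatching m n} (h : IsAdjacentMatching M M') (N : PerfectMatching m n) :
    gibbs β U N ≤
      2 * m * n * Real.exp (|β| * utilityRange U) * (gibbs β U M * P M M') := by
  set r : ℝ := Real.exp (|β| * utilityRange U)
  calc gibbs β U N ≤ r * min (gibbs β U M) (gibbs β U M') := by
        rw [mul_min_of_nonneg _ _ (Real.exp_pos _).le]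
        exact le_min (gibbs_le_exp_mul_gibbs N M) (gibbs_le_exp_mul_gibbs N M')
    _ = 2 * m * n * r * (gibbs β U M * lazyMoveProb β U M M') := by
        rw [gibbs_mul_lazyMoveProb h]
        field_simp
    _ ≤ 2 * m * n * r * (gibbs β U M * P M M') :=
        mul_le_mul_of_nonneg_left
          (mul_le_mul_of_nonneg_left (hP.move M M') (gibbs_pos M).le) (by positivity)

open scoped Pointwise in
theorem weightedVariance_le [Nonempty (PerfectMatching m n)] (hP : IsMetropolisChain β U P)
    (hm : 0 < m) (hn : 0 < n) (f : PerfectMatching m n → ℝ) :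
    weightedVariance (gibbs β U) f ≤
      4 * m * n ^ 3 * Real.exp (|β| * utilityRange U) * dirichletForm P (gibbs β U) f := by
  have htrans : MulAction.IsPretransitive (Equiv.Perm (Fin n)) (PerfectMatching m n) :=
    Equiv.Perm.isMultiplyPretransitive (Fin n) m
  obtain ⟨N, hN⟩ := Finite.exists_max (gibbs β U)
  have hword (g : Equiv.Perm (Fin n)) :
      g ∈ insert 1 {s : Equiv.Perm (Fin n) | s.IsSwap} ^ n :=
    mem_insert_one_isSwap_pow (by simpa using Finset.card_le_univ g.support)
  have hflow (s : Equiv.Perm (Fin n)) (hs : s.IsSwap) (M : PerfectMatching m n)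
      (hM : s • M ≠ M) : gibbs β U N ≤
        2 * m * n * Real.exp (|β| * utilityRange U) * (gibbs β U M * P M (s • M)) := by
    obtain ⟨a, b, -, rfl⟩ := hs
    exact hP.gibbs_le_mul_flow hm hn (isAdjacentMatching_swap_smul hM) N
  refine (weightedVariance_le_mul_dirichletForm sum_gibbs
    (fun M M' => mul_nonneg (gibbs_pos M).le (hP.stochastic.1 M M')) (by positivity)
    (gibbs_pos N) hN hword hflow f).trans_eq ?_
  ring

theorem weightedVariance_mulVec_le [Nonempty (PerfectMatching m n)] (hP : IsMetropolisChain β U P)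
    (hm : 0 < m) (hmn : m ≤ n) (f : PerfectMatching m n → ℝ) :
    weightedVariance (gibbs β U) (P.mulVec f) ≤
      (1 - (4 * n ^ 5 * Real.exp (|β| * utilityRange U))⁻¹) * weightedVariance (gibbs β U) f := by
  have hn : 0 < n := hm.trans_le hmn
  set r : ℝ := Real.exp (|β| * utilityRange U)
  set E : ℝ := dirichletForm P (gibbs β U) f
  have hE : 0 ≤ E := dirichletForm_nonneg
    (fun M M' => mul_nonneg (gibbs_pos M).le (hP.stochastic.1 M M')) f
  have hpoincare : (4 * n ^ 5 * r)⁻¹ * weightedVariance (gibbs β U) f ≤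
      2 * (1 / (2 * (n : ℝ))) * E := by
    rw [inv_mul_le_iff₀ (by positivity)]
    calc weightedVariance (gibbs β U) f ≤ 4 * m * n ^ 3 * r * E := hP.weightedVariance_le hm hn f
      _ ≤ 4 * n * n ^ 3 * r * E := by gcongr
      _ = 4 * n ^ 5 * r * (2 * (1 / (2 * (n : ℝ))) * E) := by field_simp
  linarith [hP.balance.weightedVariance_mulVec_le (fun M => (gibbs_pos M).le) sum_gibbs
    hP.stochastic hP.holding f]

theorem exists_isMixingTime_le (hP : IsMetropolisChain β U P) (hm : 0 < m) (hmn : m ≤ n) {ε : ℝ}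
    (hε : 0 < ε) :
    ∃ τ : ℕ, IsMixingTime P (gibbs β U) ε τ ∧
      (τ : ℝ) ≤ 9 * Real.exp (2 * |β| * utilityRange U) * n ^ 7 * (1 + Real.posLog (1 / ε)) := by
  have hne : Nonempty (PerfectMatching m n) := ⟨Fin.castLEEmb hmn⟩
  have hn : (1 : ℝ) ≤ n := Nat.one_le_cast.2 (hm.trans_le hmn)
  set b : ℝ := |β| * utilityRange U with hb
  have hb_nonneg : 0 ≤ b := mul_nonneg (abs_nonneg β) (utilityRange_nonneg U)
  have hr : 1 ≤ Real.exp b := Real.one_le_exp hb_nonneg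
  have hγ : (4 * n ^ 5 * Real.exp b)⁻¹ ≤ 1 := inv_le_one_of_one_le₀ <|
    one_le_mul_of_one_le_of_one_le
      (one_le_mul_of_one_le_of_one_le (by norm_num) (one_le_pow₀ hn)) hr
  obtain ⟨τ, hτ, hτ_le⟩ := hP.balance.exists_isMixingTime_le sum_gibbs hP.stochastic
    (by positivity) hγ (hP.weightedVariance_mulVec_le hm hmn) (by positivity)
    inv_pow_mul_exp_le_gibbs hε
  set L : ℝ := Real.posLog (1 / ε)
  have hL : 0 ≤ L := Real.posLog_nonneg
  have hL_le : L ≤ n ^ 2 * Real.exp b * L :=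
    le_mul_of_one_le_left hL (one_le_mul_of_one_le_of_one_le (one_le_pow₀ hn) hr)
  have hone : 1 ≤ Real.exp b ^ 2 * n ^ 7 * (1 + L) :=
    one_le_mul_of_one_le_of_one_le
      (one_le_mul_of_one_le_of_one_le (one_le_pow₀ hr) (one_le_pow₀ hn)) (by linarith)
  have hexp : Real.exp (2 * |β| * utilityRange U) = Real.exp b ^ 2 := by
    rw [hb, ← Real.exp_nat_mul, Nat.cast_two, mul_assoc]
  refine ⟨τ, hτ, ?_⟩
  calc (τ : ℝ) ≤ 4 * n ^ 5 * Real.exp b * (Real.log (n ^ m * Real.exp b) + 2 * L) + 1 := by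
        simpa only [inv_inv] using hτ_le
    _ ≤ 4 * n ^ 5 * Real.exp b * (2 * n ^ 2 * Real.exp b + 2 * (n ^ 2 * Real.exp b * L)) +
          Real.exp b ^ 2 * n ^ 7 * (1 + L) := by
        gcongr
        exact log_pow_mul_exp_le hn (Nat.cast_le.2 hmn) hb_nonneg
    _ = 9 * Real.exp (2 * |β| * utilityRange U) * n ^ 7 * (1 + L) := by
        rw [hexp]
        ring

end IsMetropolisChain

end MetropolisChains

theorem exp_mul_le_mul_pow {a A B R x : ℝ} (ha : 0 ≤ a) (hx : 1 ≤ x)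
    (hR : R ≤ A + B * Real.log x) :
    Real.exp (a * R) ≤ Real.exp (a * A) * x ^ ⌈a * B⌉₊ :=
  calc Real.exp (a * R) ≤ Real.exp (a * A + a * B * Real.log x) := by
        rw [mul_assoc, ← mul_add]
        gcongr
    _ ≤ Real.exp (a * A + ⌈a * B⌉₊ * Real.log x) := by
        have := Real.log_nonneg hx
        gcongr
        exact Nat.le_ceil _
    _ = Real.exp (a * A) * x ^ ⌈a * B⌉₊ := by
        rw [Real.exp_add, Real.exp_nat_mul, Real.exp_log (one_pos.trans_le hx)]

section RapidMixing

variable {ι : Type*} {β : ℝ} {m n : ι → ℕ} {U : ∀ i, PerfectMatching (m i) (n i) → ℝ}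

theorem rapidlyMixing_of_isMetropolisChain (hm : ∀ i, 0 < m i) (hmn : ∀ i, m i ≤ n i)
    {P : ∀ i, Matrix (PerfectMatching (m i) (n i)) (PerfectMatching (m i) (n i)) ℝ}
    (hP : ∀ i, IsMetropolisChain β (U i) (P i)) {A B : ℝ}
    (hAB : ∀ i, utilityRange (U i) ≤ A + B * Real.log (n i)) :
    RapidlyMixing n (fun i => PerfectMatching (m i) (n i)) P (fun i => gibbs β (U i)) := by
  have hne (i : ι) : Nonempty (PerfectMatching (m i) (n i)) := ⟨Fin.castLEEmb (hmn i)⟩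
  refine ⟨fun i => ⟨(hP i).stochastic, (hP i).balance.isStationaryDistribution
      (fun M => (gibbs_pos M).le) sum_gibbs (hP i).stochastic⟩,
    9 * Real.exp (2 * |β| * A), ⌈2 * |β| * B⌉₊ + 7, fun i ε hε => ?_⟩
  obtain ⟨τ, hτ, hτ_le⟩ := (hP i).exists_isMixingTime_le (hm i) (hmn i) hε
  have hexp : Real.exp (2 * |β| * utilityRange (U i)) ≤
      Real.exp (2 * |β| * A) * (n i : ℝ) ^ ⌈2 * |β| * B⌉₊ :=
    exp_mul_le_mul_pow (by positivity) (Nat.one_le_cast.2 ((hm i).trans_le (hmn i))) (hAB i)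
  have hL : 0 ≤ 1 + Real.posLog (1 / ε) := add_nonneg zero_le_one Real.posLog_nonneg
  refine ⟨τ, hτ, hτ_le.trans ?_⟩
  calc 9 * Real.exp (2 * |β| * utilityRange (U i)) * (n i : ℝ) ^ 7 * (1 + Real.posLog (1 / ε))
      ≤ 9 * (Real.exp (2 * |β| * A) * (n i : ℝ) ^ ⌈2 * |β| * B⌉₊) * (n i : ℝ) ^ 7 *
          (1 + Real.posLog (1 / ε)) := by gcongr
    _ = 9 * Real.exp (2 * |β| * A) * (n i : ℝ) ^ (⌈2 * |β| * B⌉₊ + 7) *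
          (1 + Real.posLog (1 / ε)) := by ring

theorem matchingChainRapidlyMixing_of_utilityRange_le (hm : ∀ i, 0 < m i)
    (hmn : ∀ i, m i ≤ n i)
    (h : ∃ A B : ℝ, ∀ i, utilityRange (U i) ≤ A + B * Real.log (n i)) :
    MatchingChainRapidlyMixing β m n U := by
  obtain ⟨A, B, hAB⟩ := h
  have hn (i : ι) : 0 < n i := (hm i).trans_le (hmn i)
  exact ⟨rapidlyMixing_of_isMetropolisChain hm hmn
      (fun i => isMetropolisChain_transitionMatrix (hm i) (hn i)) hAB,
    rapidlyMixing_of_isMetropolisChain hm hmn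
      (fun i => isMetropolisChain_lazyTransitionMatrix (hm i) (hn i)) hAB⟩

end RapidMixing

section LogarithmicUtilities

theorem log_sub_log_le {a b D : ℝ} (hD : 0 < D) (ha : 0 < a) (hb : 1 / D ≤ b)
    (hab : a - b ≤ D) : Real.log a - Real.log b ≤ Real.log (1 + D ^ 2) := by
  have hb_pos : 0 < b := (one_div_pos.2 hD).trans_le hb
  have hDb : 1 ≤ D * b := (div_le_iff₀' hD).1 hb
  have hle : a ≤ (1 + D ^ 2) * b :=
    calc a ≤ b + D * 1 := by linarith
      _ ≤ b + D * (D * b) := by gcongr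
      _ = (1 + D ^ 2) * b := by ring
  rw [sub_le_iff_le_add, ← Real.log_mul (by positivity) hb_pos.ne']
  exact Real.log_le_log ha hle

theorem log_one_add_mul_pow_sq_le {C x : ℝ} (hx : 1 ≤ x) (k : ℕ) :
    Real.log (1 + (C * x ^ k) ^ 2) ≤ Real.log (1 + C ^ 2) + 2 * k * Real.log x := by
  have hle : 1 + (C * x ^ k) ^ 2 ≤ (1 + C ^ 2) * x ^ (2 * k) := by
    linarith [one_le_pow₀ (n := 2 * k) hx, show (C * x ^ k) ^ 2 = C ^ 2 * x ^ (2 * k) by ring]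
  calc Real.log (1 + (C * x ^ k) ^ 2) ≤ Real.log ((1 + C ^ 2) * x ^ (2 * k)) :=
        Real.log_le_log (by positivity) hle
    _ = Real.log (1 + C ^ 2) + 2 * k * Real.log x := by
        rw [Real.log_mul (by positivity) (by positivity), Real.log_pow]
        push_cast
        rfl

theorem utilityRange_log_le {m n : ℕ} [Nonempty (PerfectMatching m n)]
    {U : PerfectMatching m n → ℝ} {D s : ℝ} (hD : 0 < D) (hrange : utilityRange U ≤ D)
    (hlow : ∀ M, 1 / D ≤ U M + s) :
    utilityRange (fun M => Real.log (U M + s)) ≤ Real.log (1 + D ^ 2) :=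
  utilityRange_le fun M M' =>
    log_sub_log_le hD ((one_div_pos.2 hD).trans_le (hlow M)) (hlow M') <|
      (add_sub_add_right_eq_sub _ _ _).trans_le ((sub_le_utilityRange U M M').trans hrange)

end LogarithmicUtilities

theorem mainTheorem3_general {ι : Type*} (β : ℝ) (m n : ι → ℕ)
    (hm : ∀ i, 0 < m i) (hmn : ∀ i, m i ≤ n i)
    (U : ∀ i, PerfectMatching (m i) (n i) → ℝ) :
    ((∃ A B : ℝ, ∀ i, utilityRange (U i) ≤ A + B * Real.log (n i)) →
      MatchingChainRapidlyMixing β m n U) ∧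
    (∀ (s : ι → ℝ) (C : ℝ) (k : ℕ), 0 < C →
      (∀ i, utilityRange (U i) ≤ C * (n i : ℝ) ^ k) →
      (∀ i M, 1 / (C * (n i : ℝ) ^ k) ≤ U i M + s i) →
      (∀ i M, (∀ M', U i M' ≤ U i M) ↔
        ∀ M', Real.log (U i M' + s i) ≤ Real.log (U i M + s i)) ∧
      (∃ A B : ℝ, ∀ i, utilityRange (fun M => Real.log (U i M + s i)) ≤
        A + B * Real.log (n i)) ∧
      MatchingChainRapidlyMixing β m n (fun i M => Real.log (U i M + s i))) := by
  refine ⟨matchingChainRapidlyMixing_of_utilityRange_le hm hmn, fun s C k hC hrange hlow => ?_⟩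
  have hn (i : ι) : (1 : ℝ) ≤ n i := Nat.one_le_cast.2 ((hm i).trans_le (hmn i))
  have hD (i : ι) : 0 < C * (n i : ℝ) ^ k := mul_pos hC (pow_pos (one_pos.trans_le (hn i)) k)
  have hpos (i : ι) (M : PerfectMatching (m i) (n i)) : 0 < U i M + s i :=
    (one_div_pos.2 (hD i)).trans_le (hlow i M)
  have hlog : ∃ A B : ℝ, ∀ i, utilityRange (fun M => Real.log (U i M + s i)) ≤
      A + B * Real.log (n i) := by
    refine ⟨Real.log (1 + C ^ 2), 2 * k, fun i => ?_⟩
    have hne : Nonempty (PerfectMatching (m i) (n i)) := ⟨Fin.castLEEmb (hmn i)⟩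
    exact (utilityRange_log_le (hD i) (hrange i) (hlow i)).trans
      (log_one_add_mul_pow_sq_le (hn i) k)
  refine ⟨fun i M => forall_congr' fun M' => ?_, hlog,
    matchingChainRapidlyMixing_of_utilityRange_le hm hmn hlog⟩
  rw [Real.log_le_log_iff (hpos i M') (hpos i M), add_le_add_iff_right]

theorem mainTheorem3 {ι : Type*} (β : ℝ) (hβ : 0 ≤ β) (m n : ι → ℕ)
    (hm : ∀ i, 0 < m i) (hmn : ∀ i, m i ≤ n i)
    (U : ∀ i, PerfectMatching (m i) (n i) → ℝ) :
    -- `U_max - U_min` is bounded or grows at most logarithmically in the input size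
    ((∃ A B : ℝ, ∀ i, utilityRange (U i) ≤ A + B * Real.log (n i)) →
      MatchingChainRapidlyMixing β m n U) ∧
    -- `U_max - U_min` grows at most polynomially: pass to the logarithm of the (shifted) utility
    (∀ (s : ι → ℝ) (C : ℝ) (k : ℕ), 0 < C →
      (∀ i, utilityRange (U i) ≤ C * (n i : ℝ) ^ k) →
      (∀ i M, 1 / (C * (n i : ℝ) ^ k) ≤ U i M + s i) →
      (∀ i M, (∀ M', U i M' ≤ U i M) ↔
        ∀ M', Real.log (U i M' + s i) ≤ Real.log (U i M + s i)) ∧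
      (∃ A B : ℝ, ∀ i, utilityRange (fun M => Real.log (U i M + s i)) ≤
        A + B * Real.log (n i)) ∧
      MatchingChainRapidlyMixing β m n (fun i M => Real.log (U i M + s i))) :=
  mainTheorem3_general β m n hm hmn U
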